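/- Let $S$ be a closed (compact, connected) surface with a metric $d$ and finitely many distinct points $s_1,\dots,s_n\in S$ (the conical points) such that every $p\in S\setminus\{s_1,\dots,s_n\}$ has a neighbourhood isometric to an open disk in the Euclidean plane, and every $s_i$ has a neighbourhood isometric, by an isometry that takes $s_i$ to $v$, to a neighbourhood of the vertex $v$ of the standard cone $C(v,\theta_i)=\{(r,t): r\ge 0,\ t\in\mathbb R/\theta_i\mathbb Z\}$ (all points $(0,t)$ being identified with $v$) with the length metric of $ds^2=dr^2+r^2dt^2$, where $\theta_i\in(2\pi,\infty)$. Let $GS$ be the space, with the compact-open topology, of all local isometric maps $\gamma:\mathbb R\to S$, that is, maps such that every $t\in\mathbb R$ has a neighbourhood on which $\gamma$ preserves distances. For $t\in\mathbb R$ and $\gamma\in GS$ let $t\cdot\gamma\in GS$ be given by $(t\cdot\gamma)(u)=\gamma(t+u)$ (the geodesic flow). Let $g\in GS$ be such that $g(t)\notin\{s_1,\dots,s_n\}$ for all $t\in\mathbb R$, let $\mathcal U=\{t\cdot g: t\in\mathbb R\}$, and let $\overline{\mathcal U}$ be its closure in $GS$. Then the following are equivalent: (a) $g$ is not periodic, i.e.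 there is no $T>0$ with $g(t+T)=g(t)$ for all $t\in\mathbb R$; (b) $\overline{\mathcal U}\setminus\mathcal U\neq\emptyset$, that is, $\mathcal U$ is not closed in $GS$. -/

import Mathlib

namespace ConeSurface

open Topology Metric

/-- Polar coordinates `(r, t)`, with `0 ≤ r` and `t ∈ ℝ/θℤ`. -/
structure Polar (θ : ℝ) where
  /-- the distance from the vertex -/
  radius : NNReal
  /-- the angular coordinate -/
  angle : AddCircle θ

namespace Polar

/-- Distance of `(r, t)` and `(r', t')` for the length metric of `dr² + r² dt²`: if the distance `α`
of `t` and `t'` in the circle `ℝ/θℤ` is at most `π`, it is given by the law of cosines with angle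
`α`; otherwise the shortest path goes through the vertex and has length `r + r'`, which is the law
of cosines with angle `π`. -/
noncomputable def coneDist {θ : ℝ} (x y : Polar θ) : ℝ :=
  Real.sqrt ((x.radius : ℝ) ^ 2 + (y.radius : ℝ) ^ 2
    - 2 * x.radius * y.radius * Real.cos (min ‖x.angle - y.angle‖ Real.pi))

/-- The law of cosines in `ℂ`. -/
theorem norm_polar_sub (a b u v : ℝ) :
    ‖(a : ℂ) * Complex.exp (u * Complex.I) - b * Complex.exp (v * Complex.I)‖
      = Real.sqrt (a ^ 2 + b ^ 2 - 2 * a * b * Real.cos (u - v)) := by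
  rw [← Real.sqrt_sq (norm_nonneg _), ← Complex.normSq_eq_norm_sq, Complex.normSq_apply]
  congr 1
  simp [Complex.exp_ofReal_mul_I_re, Complex.exp_ofReal_mul_I_im, Real.cos_sub]
  nlinarith [Real.sin_sq_add_cos_sq u, Real.sin_sq_add_cos_sq v]

theorem cosines_triangle {a b c α β γ : ℝ} (ha : 0 ≤ a) (hb : 0 ≤ b) (hc : 0 ≤ c)
    (hα' : α ≤ Real.pi) (hβ : 0 ≤ β) (hβ' : β ≤ Real.pi)
    (hγ : 0 ≤ γ) (hγ' : γ ≤ Real.pi) (h : γ ≤ α + β) :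
    Real.sqrt (a ^ 2 + c ^ 2 - 2 * a * c * Real.cos γ)
      ≤ Real.sqrt (a ^ 2 + b ^ 2 - 2 * a * b * Real.cos α)
        + Real.sqrt (b ^ 2 + c ^ 2 - 2 * b * c * Real.cos β) := by
  obtain ⟨β₁, h1, h2, h3, h4⟩ :
      ∃ β₁, β₁ ≤ β ∧ 0 ≤ β₁ ∧ γ ≤ α + β₁ ∧ α + β₁ ≤ Real.pi := by
    rcases le_total (α + β) Real.pi with h' | h'
    · exact ⟨β, le_rfl, hβ, h, h'⟩
    · exact ⟨Real.pi - α, by linarith, by linarith, by linarith, by linarith⟩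
  have hcos : Real.cos (α + β₁) ≤ Real.cos γ :=
    Real.cos_le_cos_of_nonneg_of_le_pi hγ h4 h3
  have hcos' : Real.cos β ≤ Real.cos β₁ :=
    Real.cos_le_cos_of_nonneg_of_le_pi h2 hβ' h1
  have key := norm_sub_le_norm_sub_add_norm_sub
    ((a : ℂ) * Complex.exp ((α : ℝ) * Complex.I))
    ((b : ℂ) * Complex.exp ((0 : ℝ) * Complex.I))
    ((c : ℂ) * Complex.exp ((-β₁ : ℝ) * Complex.I))
  rw [norm_polar_sub, norm_polar_sub, norm_polar_sub] at key
  simp only [sub_neg_eq_add, sub_zero, zero_add] at key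
  refine le_trans (Real.sqrt_le_sqrt ?_) (key.trans (add_le_add le_rfl (Real.sqrt_le_sqrt ?_)))
  · nlinarith [mul_nonneg ha hc]
  · nlinarith [mul_nonneg hb hc]

noncomputable instance {θ : ℝ} : PseudoMetricSpace (Polar θ) where
  dist := coneDist
  dist_self x := by
    have : ((x.radius : ℝ) ^ 2 + (x.radius : ℝ) ^ 2 - 2 * x.radius * x.radius) = 0 := by ring
    simp [coneDist, Real.pi_pos.le, this]
  dist_comm x y := by
    simp only [coneDist, norm_sub_rev x.angle y.angle]
    congr 1
    ring
  dist_triangle x y z := by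
    have hπ := Real.pi_pos.le
    refine cosines_triangle x.radius.2 y.radius.2 z.radius.2 (min_le_right _ _)
      (le_min (norm_nonneg _) hπ) (min_le_right _ _) (le_min (norm_nonneg _) hπ) (min_le_right _ _) ?_
    have h := norm_sub_le_norm_sub_add_norm_sub x.angle y.angle z.angle
    have h1 := norm_nonneg (x.angle - y.angle)
    have h2 := norm_nonneg (y.angle - z.angle)
    rcases le_total ‖x.angle - y.angle‖ Real.pi with h3 | h3 <;>
    rcases le_total ‖y.angle - z.angle‖ Real.pi with h4 | h4 <;>
    simp only [min_eq_left, min_eq_right, h3, h4] <;>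
    first
      | exact (min_le_left _ _).trans h
      | exact (min_le_right _ _).trans (by linarith)

end Polar

/-- The standard cone `C(v, θ)` with its metric: polar coordinates, with points at distance `0`
(that is, all `(0, t)`) identified. -/
abbrev Cone (θ : ℝ) : Type := SeparationQuotient (Polar θ)

/-- The vertex `v` of the standard cone. -/
noncomputable def vertex (θ : ℝ) : Cone θ := SeparationQuotient.mk ⟨0, 0⟩

/-- `S` is a Euclidean surface with the distinct conical singularities `s i` of angle `θ i`: a closed
(compact, connected, boundaryless) surface with a metric that is locally Euclidean away from the
`s i` and locally a standard cone of angle `θ i`, with vertex at `s i`, at `s i`. -/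
structure IsEuclideanConeSurface (S : Type*) [MetricSpace S] {n : ℕ}
    (s : Fin n → S) (θ : Fin n → ℝ) : Prop where
  compact : CompactSpace S
  connected : ConnectedSpace S
  injective : Function.Injective s
  angle_pos : ∀ i, 0 < θ i
  regular : ∀ p, p ∉ Set.range s →
    ∃ U ∈ 𝓝 p, ∃ (c : EuclideanSpace ℝ (Fin 2)) (r : ℝ), 0 < r ∧ Nonempty (U ≃ᵢ ball c r)
  conical : ∀ i, ∃ U ∈ 𝓝 (s i), ∃ V ∈ 𝓝 (vertex (θ i)), ∃ e : U ≃ᵢ V,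
    ∀ x : U, (x : S) = s i → (e x : Cone (θ i)) = vertex (θ i)

/-- Local isometric maps: every point has a neighbourhood on which distances are preserved. -/
def IsLocalIsometric {X Y : Type*} [PseudoMetricSpace X] [PseudoMetricSpace Y] (f : X → Y) : Prop :=
  ∀ x, ∃ U ∈ 𝓝 x, ∀ a ∈ U, ∀ b ∈ U, dist (f a) (f b) = dist a b

/-- The space `GS` of all local isometric maps `ℝ → S`. It carries the subspace topology of
`C(ℝ, S)`, which is the compact-open topology. -/
abbrev GeodesicSpace (S : Type*) [MetricSpace S] : Type _ :=
  {γ : C(ℝ, S) // IsLocalIsometric γ}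

/-- The geodesic flow: `(t · γ)(u) = γ (t + u)`. -/
def geodesicFlow {S : Type*} [MetricSpace S] (t : ℝ) (γ : GeodesicSpace S) : GeodesicSpace S :=
  ⟨γ.1.comp ⟨fun u => t + u, by fun_prop⟩, fun u => by
    obtain ⟨U, hU, h⟩ := γ.2 (t + u)
    refine ⟨(fun u => t + u) ⁻¹' U,
      (continuous_const.add continuous_id).continuousAt.preimage_mem_nhds hU, fun a ha b hb => ?_⟩
    simpa using h (t + a) ha (t + b) hb⟩

/-- The orbit `{t · γ | t ∈ ℝ}` of `γ` under the geodesic flow. -/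
def flowOrbit {S : Type*} [MetricSpace S] (γ : GeodesicSpace S) : Set (GeodesicSpace S) :=
  Set.range fun t : ℝ => geodesicFlow t γ

/-- `γ` is a periodic map. -/
def IsPeriodic {S : Type*} [MetricSpace S] (γ : GeodesicSpace S) : Prop :=
  ∃ T : ℝ, 0 < T ∧ Function.Periodic γ.1 T

end ConeSurface

/-! A periodic orbit is the image of a compact interval, hence closed. Conversely, a closed orbit is
shown to be compact, and a compact orbit to be periodic. Compactness rests on a uniform scale `δ` on
which local geodesics avoiding the conical points are geodesics
(`IsEuclideanConeSurface.exists_scale`). Every translate of `g` lies in the set of maps preserving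
distances below `δ`, which is compact by Arzelà–Ascoli. The scale comes from charts and a Lebesgue
number. In a flat chart, local geodesics are straight segments. In a cone of angle greater than
`2π`, one that misses the vertex develops onto a straight segment in an open half-plane, and
half-planes embed isometrically in the cone (`Polar.dist_eq_of_preservesDistAt`). Small cone angles
would break this, since lines close to the vertex would stop minimizing. A compact orbit is a
countable union of compact arcs, so by Baire one arc has interior in the orbit. Recurrence brings
the orbit back into that arc at a later time, which gives a period. -/

namespace ConeSurface

open Topology Metric Set Filter

/-- `f` preserves distances on a neighbourhood of `t`. -/
def PreservesDistAt {X : Type*} [PseudoMetricSpace X] (f : ℝ → X) (t : ℝ) : Prop :=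
  ∃ U ∈ 𝓝 t, ∀ a ∈ U, ∀ b ∈ U, dist (f a) (f b) = dist a b

/-! ### Isometric paths in strictly convex spaces and unique continuation -/

section Affine

variable {E : Type*} [NormedAddCommGroup E] [NormedSpace ℝ E] [StrictConvexSpace ℝ E]

/-- Each `f t` realizes equality in the triangle inequality between `f a` and `f b`; strict
convexity then puts it on the segment. -/
theorem eq_add_smul_of_dist_eq {f : ℝ → E} {a b : ℝ} (hab : a < b)
    (h : ∀ x ∈ Icc a b, ∀ y ∈ Icc a b, dist (f x) (f y) = dist x y) :
    ∃ w : E, ‖w‖ = 1 ∧ ∀ t ∈ Icc a b, f t = f a + (t - a) • w := by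
  have hab' : 0 < b - a := sub_pos.2 hab
  have hA : a ∈ Icc a b := left_mem_Icc.2 hab.le
  have hB : b ∈ Icc a b := right_mem_Icc.2 hab.le
  have hfab : dist (f a) (f b) = b - a := by
    rw [h a hA b hB, dist_comm, Real.dist_eq, abs_of_pos hab']
  refine ⟨(b - a)⁻¹ • (f b - f a), ?_, fun t ht => ?_⟩
  · rw [norm_smul, ← dist_eq_norm, dist_comm, hfab, Real.norm_of_nonneg (inv_nonneg.2 hab'.le),
      inv_mul_cancel₀ hab'.ne']
  · have key := eq_lineMap_of_dist_eq_mul_of_dist_eq_mul (x := f a) (y := f t) (z := f b)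
      (r := (t - a) / (b - a)) (by
        rw [hfab, h a hA t ht, dist_comm, Real.dist_eq, abs_of_nonneg (by linarith [ht.1])]
        field_simp) (by
        rw [hfab, h t ht b hB, dist_comm, Real.dist_eq, abs_of_nonneg (by linarith [ht.2])]
        field_simp
        ring)
    rw [key, AffineMap.lineMap_apply_module', smul_smul, div_eq_mul_inv, add_comm]

theorem eqOn_Icc_of_dist_eq {f m : ℝ → E} {a b x y : ℝ}
    (hf : ∀ x ∈ Icc a b, ∀ y ∈ Icc a b, dist (f x) (f y) = dist x y)
    (hm : ∀ x ∈ Icc a b, ∀ y ∈ Icc a b, dist (m x) (m y) = dist x y)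
    (hx : x ∈ Icc a b) (hy : y ∈ Icc a b) (hxy : x ≠ y) (h1 : f x = m x) (h2 : f y = m y) :
    EqOn f m (Icc a b) := by
  have hab : a < b := by
    rcases lt_or_gt_of_ne hxy with h | h
    · exact hx.1.trans_lt (h.trans_le hy.2)
    · exact hy.1.trans_lt (h.trans_le hx.2)
  obtain ⟨w, -, hw⟩ := eq_add_smul_of_dist_eq hab hf
  obtain ⟨w', -, hw'⟩ := eq_add_smul_of_dist_eq hab hm
  rw [hw x hx, hw' x hx] at h1
  rw [hw y hy, hw' y hy] at h2
  have h3 : (y - x) • (w - w') = 0 := by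
    have : (y - x) • (w - w')
        = (f a + (y - a) • w) - (f a + (x - a) • w)
          - ((m a + (y - a) • w') - (m a + (x - a) • w')) := by module
    rw [this, h1, h2, sub_self]
  have hww : w = w' := by
    rcases smul_eq_zero.1 h3 with h | h
    · exact absurd (sub_eq_zero.1 h).symm hxy
    · exact sub_eq_zero.1 h
  subst hww
  have h4 : f a = m a := add_right_cancel h1
  intro t ht
  rw [hw t ht, hw' t ht, h4]

/-- Two maps that preserve distances near `t` and coincide on open sets accumulating at `t`
coincide near `t`, if the target is flat at their common value. -/
theorem eventually_dist_eq_zero {X : Type*} [PseudoMetricSpace X] {f m : ℝ → X} {t ρ : ℝ}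
    (hf : PreservesDistAt f t) (hm : PreservesDistAt m t) (h0 : dist (f t) (m t) = 0)
    (hρ : 0 < ρ) (ψ : X → E)
    (hψ : ∀ x ∈ ball (f t) ρ, ∀ y ∈ ball (f t) ρ, dist (ψ x) (ψ y) = dist x y)
    (hcl : t ∈ closure {s | ∀ᶠ r in 𝓝 s, dist (f r) (m r) = 0}) :
    ∀ᶠ s in 𝓝 t, dist (f s) (m s) = 0 := by
  obtain ⟨U, hU, hfU⟩ := hf
  obtain ⟨V, hV, hmV⟩ := hm
  obtain ⟨ε₀, hε₀, hball⟩ := Metric.mem_nhds_iff.1 (inter_mem hU hV)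
  obtain ⟨ε, hε, hε1, hε2⟩ : ∃ ε, 0 < ε ∧ ε < ε₀ ∧ ε < ρ :=
    ⟨min ε₀ ρ / 2, by positivity, by linarith [min_le_left ε₀ ρ, lt_min hε₀ hρ],
      by linarith [min_le_right ε₀ ρ, lt_min hε₀ hρ]⟩
  have hsub : closedBall t ε ⊆ U ∩ V := (closedBall_subset_ball hε1).trans hball
  have htε : t ∈ closedBall t ε := mem_closedBall_self hε.le
  have hfb : ∀ s ∈ closedBall t ε, f s ∈ ball (f t) ρ := fun s hs => by
    rw [mem_ball, hfU s (hsub hs).1 t (hsub htε).1]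
    exact (mem_closedBall.1 hs).trans_lt hε2
  have hmb : ∀ s ∈ closedBall t ε, m s ∈ ball (f t) ρ := fun s hs => by
    have h1 := dist_triangle_right (m s) (f t) (m t)
    rw [hmV s (hsub hs).2 t (hsub htε).2, h0, add_zero] at h1
    exact h1.trans_lt ((mem_closedBall.1 hs).trans_lt hε2)
  -- Coincidence near one point `s` of the interval yields two distinct points of coincidence, `s`
  -- and `s + δ / 2`, and two points determine a straight path.
  obtain ⟨s, hs, hst⟩ := Metric.mem_closure_iff.1 hcl ε hε
  have hs' : ∀ᶠ r in 𝓝 s, dist (f r) (m r) = 0 ∧ r ∈ closedBall t ε :=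
    Eventually.and hs (mem_of_superset (isOpen_ball.mem_nhds
      (mem_ball.2 ((dist_comm s t).trans_lt hst))) ball_subset_closedBall)
  obtain ⟨δ, hδ, hsδ⟩ := Metric.eventually_nhds_iff.1 hs'
  have hs0 := hsδ (y := s) (by simpa using hδ)
  have hs1 := hsδ (y := s + δ / 2) (by simp [abs_of_pos hδ, hδ])
  have hψe : ∀ r ∈ closedBall t ε, (ψ (f r) = ψ (m r) ↔ dist (f r) (m r) = 0) := fun r hr => by
    rw [← dist_eq_zero, hψ _ (hfb r hr) _ (hmb r hr)]
  have key : EqOn (ψ ∘ f) (ψ ∘ m) (closedBall t ε) := by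
    have hs0' := (hψe _ hs0.2).2 hs0.1
    have hs1' := (hψe _ hs1.2).2 hs1.1
    have m0 := hs0.2
    have m1 := hs1.2
    have Hf : ∀ x ∈ closedBall t ε, ∀ y ∈ closedBall t ε, dist ((ψ ∘ f) x) ((ψ ∘ f) y) = dist x y :=
      fun x hx y hy =>
        (hψ _ (hfb x hx) _ (hfb y hy)).trans (hfU x (hsub hx).1 y (hsub hy).1)
    have Hm : ∀ x ∈ closedBall t ε, ∀ y ∈ closedBall t ε, dist ((ψ ∘ m) x) ((ψ ∘ m) y) = dist x y :=
      fun x hx y hy =>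
        (hψ _ (hmb x hx) _ (hmb y hy)).trans (hmV x (hsub hx).2 y (hsub hy).2)
    rw [Real.closedBall_eq_Icc] at *
    exact eqOn_Icc_of_dist_eq Hf Hm m0 m1 (by linarith) hs0' hs1'
  filter_upwards [closedBall_mem_nhds t hε] with r hr
  exact (hψe r hr).1 (key hr)

end Affine

section Local

variable {X : Type*} [PseudoMetricSpace X] {f : ℝ → X} {t : ℝ}

theorem PreservesDistAt.continuousAt (hf : PreservesDistAt f t) : ContinuousAt f t := by
  obtain ⟨U, hU, h⟩ := hf
  rw [Metric.continuousAt_iff']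
  intro ε hε
  filter_upwards [hU, Metric.ball_mem_nhds t hε] with s hs hs'
  rw [h s hs t (mem_of_mem_nhds hU)]
  exact hs'

/-- A local isometric map on an interval into a strictly convex normed space is isometric. -/
theorem dist_eq_of_preservesDistAt {E : Type*} [NormedAddCommGroup E] [NormedSpace ℝ E]
    [StrictConvexSpace ℝ E] {f : ℝ → E} {I : Set ℝ} (hI : IsPreconnected I)
    (hf : ∀ t ∈ I, PreservesDistAt f t) :
    ∀ x ∈ I, ∀ y ∈ I, dist (f x) (f y) = dist x y := by
  intro x hx y hy
  obtain ⟨U, hU, hfU⟩ := hf x hx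
  obtain ⟨ε, hε, hball⟩ := Metric.nhds_basis_closedBall.mem_iff.1 hU
  rw [Real.closedBall_eq_Icc] at hball
  obtain ⟨w, hw, hfw⟩ := eq_add_smul_of_dist_eq (by linarith : x - ε < x + ε)
    fun a ha b hb => hfU a (hball ha) b (hball hb)
  set m : ℝ → E := fun t => f (x - ε) + (t - (x - ε)) • w with hm
  have hmd : ∀ a b, dist (m a) (m b) = dist a b := fun a b => by
    have : m a - m b = (a - b) • w := by simp only [hm]; module
    rw [dist_eq_norm, this, norm_smul, hw, mul_one, Real.dist_eq, Real.norm_eq_abs]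
  have hmc : Continuous m := by fun_prop
  have hxu : ∀ᶠ r in 𝓝 x, dist (f r) (m r) = 0 := by
    filter_upwards [Icc_mem_nhds (by linarith : x - ε < x) (by linarith : x < x + ε)] with r hr
    rw [hfw r hr, dist_self]
  -- The set where `f` agrees locally with the line `m` is open and relatively closed in the
  -- connected set `I`.
  have hsub : I ⊆ {s | ∀ᶠ r in 𝓝 s, dist (f r) (m r) = 0} := by
    refine hI.subset_of_closure_inter_subset isOpen_setOfPred_eventually_nhds ⟨x, hx, hxu⟩ ?_
    rintro t ⟨htc, htI⟩
    have hcont : ContinuousAt (fun r => dist (f r) (m r)) t :=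
      (hf t htI).continuousAt.dist hmc.continuousAt
    have h0 : dist (f t) (m t) = 0 := by
      have hfr : ∃ᶠ r in 𝓝 t, dist (f r) (m r) ∈ ({0} : Set ℝ) :=
        (mem_closure_iff_frequently.1 htc).mono fun r hr => hr.self_of_nhds
      exact isClosed_singleton.mem_of_frequently_of_tendsto hfr hcont
    exact eventually_dist_eq_zero (hf t htI) ⟨univ, univ_mem, fun a _ b _ => hmd a b⟩ h0
      one_pos id (fun _ _ _ _ => rfl) htc
  have e1 := dist_eq_zero.1 (hsub hx).self_of_nhds
  have e2 := dist_eq_zero.1 (hsub hy).self_of_nhds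
  rw [e1, e2, hmd]

end Local

end ConeSurface

/-! ### Geometry of the cone of angle greater than `2π` -/

namespace ConeSurface

open Topology Metric Set Filter

namespace Polar

variable {θ : ℝ}

theorem dist_def (x y : Polar θ) : dist x y = Real.sqrt ((x.radius : ℝ) ^ 2 + (y.radius : ℝ) ^ 2
    - 2 * x.radius * y.radius * Real.cos (min ‖x.angle - y.angle‖ Real.pi)) := rfl

theorem abs_radius_sub_le (x y : Polar θ) : |(x.radius : ℝ) - y.radius| ≤ dist x y := by
  rw [dist_def]
  apply Real.abs_le_sqrt
  have := mul_le_mul_of_nonneg_left (Real.cos_le_one (min ‖x.angle - y.angle‖ Real.pi))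
    (mul_nonneg x.radius.coe_nonneg y.radius.coe_nonneg)
  linarith

theorem continuous_radius : Continuous fun x : Polar θ => (x.radius : ℝ) :=
  (LipschitzWith.mk_one fun x y => abs_radius_sub_le x y).continuous

theorem radius_eq_of_dist_eq_zero {x y : Polar θ} (h : dist x y = 0) :
    (x.radius : ℝ) = y.radius :=
  sub_eq_zero.1 (abs_nonpos_iff.1 ((abs_radius_sub_le x y).trans h.le))

/-- An angle of at least `π / 2` has nonpositive cosine, so the law of cosines forces a distance of
at least `y.radius`. Hence two points of the ball of radius `y.radius` about `y` differ in angle by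
less than `π`, the range where distances are Euclidean. -/
theorem norm_angle_sub_lt {x y : Polar θ} (h : dist x y < y.radius) :
    ‖x.angle - y.angle‖ < Real.pi / 2 := by
  by_contra! hc
  have hcos : Real.cos (min ‖x.angle - y.angle‖ Real.pi) ≤ 0 :=
    Real.cos_nonpos_of_pi_div_two_le_of_le (le_min hc (by linarith [Real.pi_pos]))
      ((min_le_right _ _).trans (by linarith [Real.pi_pos]))
  refine h.not_ge ?_
  rw [dist_def]
  apply Real.le_sqrt_of_sq_le
  have := mul_nonpos_of_nonneg_of_nonpos
    (mul_nonneg x.radius.coe_nonneg y.radius.coe_nonneg) hcos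
  linarith [sq_nonneg (x.radius : ℝ)]

theorem norm_coe_of_abs_le (hθ : 2 * Real.pi < θ) {x : ℝ} (hx : |x| ≤ Real.pi) :
    ‖(x : AddCircle θ)‖ = |x| := by
  have h := Real.pi_pos
  refine (AddCircle.norm_coe_eq_abs_iff θ (by linarith)).2 ?_
  rw [abs_of_pos (by linarith : 0 < θ)]
  linarith

/-- If the angles differ by at most `π`, distances in the cone are Euclidean. -/
theorem dist_eq_norm_sub (hθ : 2 * Real.pi < θ) (x y : Polar θ) {u v : ℝ}
    (huv : x.angle - y.angle = ((u - v : ℝ) : AddCircle θ)) (h : |u - v| ≤ Real.pi) :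
    dist x y = ‖(x.radius : ℂ) * Complex.exp (u * Complex.I)
      - (y.radius : ℂ) * Complex.exp (v * Complex.I)‖ := by
  have := norm_polar_sub x.radius y.radius u v
  rw [dist_def, huv, norm_coe_of_abs_le hθ h, min_eq_left h, Real.cos_abs]
  exact this.symm

/-- The point of the cone with coordinate `z` in the half-plane whose axis has angle `a`. -/
noncomputable def ofComplex (a : AddCircle θ) (z : ℂ) : Polar θ :=
  ⟨‖z‖₊, a + (Complex.arg z : AddCircle θ)⟩

theorem dist_ofComplex (hθ : 2 * Real.pi < θ) (a : AddCircle θ) {z z' : ℂ}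
    (hz : 0 < z.re) (hz' : 0 < z'.re) :
    dist (ofComplex a z) (ofComplex a z') = dist z z' := by
  have h1 := Complex.abs_arg_lt_pi_div_two_iff.2 (Or.inl hz)
  have h2 := Complex.abs_arg_lt_pi_div_two_iff.2 (Or.inl hz')
  rw [dist_eq_norm_sub hθ (u := z.arg) (v := z'.arg)]
  · simp [ofComplex, Complex.norm_mul_exp_arg_mul_I, dist_eq_norm]
  · simp [ofComplex]
  · rw [abs_lt] at h1 h2
    rw [abs_le]
    constructor <;> linarith

/-- Every point of the cone except the vertex has a flat neighbourhood, with a chart that inverts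
`ofComplex`. -/
theorem exists_chart (hθ : 2 * Real.pi < θ) (p : Polar θ) :
    ∃ ψ : Polar θ → ℂ, (∀ x ∈ ball p p.radius, ∀ y ∈ ball p p.radius,
        dist (ψ x) (ψ y) = dist x y) ∧
      ψ p = p.radius ∧ ∀ u z : ℂ, ‖u‖ = 1 → 0 < u.re → 0 < (u * z).re →
        ψ (ofComplex (p.angle - (u.arg : AddCircle θ)) (u * z)) = z := by
  have hpi := Real.pi_pos
  have : Fact (0 < θ) := ⟨by linarith⟩
  -- The representative in `(-θ/2, θ/2]` has absolute value equal to the circle norm.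
  let lift : AddCircle θ → ℝ := fun a => AddCircle.equivIoc θ (-(θ / 2)) a
  have hlift : ∀ a, ((lift a : ℝ) : AddCircle θ) = a := fun a =>
    (AddCircle.equivIoc θ (-(θ / 2))).symm_apply_apply a
  have hmem : ∀ a, lift a ∈ Ioc (-(θ / 2)) (-(θ / 2) + θ) := fun a =>
    (AddCircle.equivIoc θ (-(θ / 2)) a).2
  have hnorm : ∀ a, |lift a| = ‖a‖ := fun a => by
    conv_rhs => rw [← hlift a]
    symm
    refine (AddCircle.norm_coe_eq_abs_iff θ (by linarith)).2 ?_
    rw [abs_of_pos (by linarith : 0 < θ), abs_le]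
    constructor <;> linarith [(hmem a).1, (hmem a).2]
  have hcoe : ∀ x : ℝ, |x| < Real.pi → lift (x : AddCircle θ) = x := fun x hx => by
    rw [abs_lt] at hx
    have := AddCircle.equivIoc_coe_of_mem (p := θ) (a := -(θ / 2)) (y := x)
      ⟨by linarith, by linarith⟩
    exact this
  refine ⟨fun x => (x.radius : ℂ) * Complex.exp (lift (x.angle - p.angle) * Complex.I),
    fun x hx y hy => ?_, ?_, fun u z hu hre hz => ?_⟩
  · have h1 := norm_angle_sub_lt (mem_ball.1 hx)
    have h2 := norm_angle_sub_lt (mem_ball.1 hy)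
    rw [← hnorm, abs_lt] at h1 h2
    rw [dist_eq_norm, ← dist_eq_norm_sub hθ]
    · rw [AddCircle.coe_sub, hlift, hlift]
      abel
    · rw [abs_le]
      constructor <;> linarith
  · have := hcoe 0 (by simpa using hpi)
    simp only [AddCircle.coe_zero] at this
    simp [this]
  · have h1 := Complex.abs_arg_lt_pi_div_two_iff.2 (Or.inl hre)
    have h2 := Complex.abs_arg_lt_pi_div_two_iff.2 (Or.inl hz)
    rw [abs_lt] at h1 h2
    have h3 : (ofComplex (p.angle - (u.arg : AddCircle θ)) (u * z)).angle - p.angle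
        = (((u * z).arg - u.arg : ℝ) : AddCircle θ) := by
      simp only [ofComplex, AddCircle.coe_sub]
      abel
    have h4 : Complex.exp (u.arg * Complex.I) = u := by
      have := Complex.norm_mul_exp_arg_mul_I u
      rwa [hu, Complex.ofReal_one, one_mul] at this
    have h5 : u ≠ 0 := by
      rintro rfl
      simp at hu
    simp only [h3]
    rw [hcoe _ (by rw [abs_lt]; constructor <;> linarith)]
    simp only [ofComplex, coe_nnnorm, Complex.ofReal_sub, sub_mul, Complex.exp_sub, h4]
    rw [← mul_div_assoc, Complex.norm_mul_exp_arg_mul_I]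
    field_simp

end Polar

/-- Chooses the half-plane containing a line of direction `w` through a positive real point: a
nonradial line is rotated to a vertical one on the right of the origin, a radial one stays on the
real axis. -/
theorem exists_rotation {w : ℂ} (hw : ‖w‖ = 1) :
    ∃ u : ℂ, ‖u‖ = 1 ∧ 0 < u.re ∧ ((u * w).re = 0 ∨ (u.im = 0 ∧ (u * w).im = 0)) := by
  rcases lt_trichotomy w.im 0 with h | h | h
  · exact ⟨-Complex.I * (starRingEnd ℂ) w, by simp [hw], by simpa using h, Or.inl (by simp; ring)⟩
  · exact ⟨1, by simp, by simp, Or.inr (by simp [h])⟩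
  · exact ⟨Complex.I * (starRingEnd ℂ) w, by simp [hw], by simpa using h, Or.inl (by simp; ring)⟩

/-- A local isometric map on an interval into a cone of angle greater than `2π` that avoids the
vertex is isometric. -/
theorem Polar.dist_eq_of_preservesDistAt {θ : ℝ} (hθ : 2 * Real.pi < θ) {f : ℝ → Polar θ}
    {I : Set ℝ} (hI : IsPreconnected I) (hf : ∀ t ∈ I, PreservesDistAt f t)
    (hr : ∀ t ∈ I, 0 < (f t).radius) :
    ∀ x ∈ I, ∀ y ∈ I, dist (f x) (f y) = dist x y := by
  intro x hx y hy
  obtain ⟨ψ, hψ, hψp, hψi⟩ := exists_chart hθ (f x)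
  have hrx : (0 : ℝ) < (f x).radius := hr x hx
  obtain ⟨U, hU, hfU⟩ := hf x hx
  obtain ⟨ε, hε, hball⟩ := Metric.nhds_basis_closedBall.mem_iff.1 (inter_mem hU
    ((hf x hx).continuousAt.preimage_mem_nhds (ball_mem_nhds _ hrx)))
  rw [Real.closedBall_eq_Icc] at hball
  obtain ⟨w, hw, hfw⟩ := eq_add_smul_of_dist_eq (f := ψ ∘ f) (by linarith : x - ε < x + ε)
    fun a ha b hb => (hψ _ (hball ha).2 _ (hball hb).2).trans (hfU a (hball ha).1 b (hball hb).1)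
  -- The straight line that develops `f` in the chart at `f x`; the chart puts `f x` on the positive
  -- real axis.
  set ζ : ℝ → ℂ := fun t => (f x).radius + (t - x : ℝ) * w with hζ
  have hfζ : ∀ t ∈ Icc (x - ε) (x + ε), ψ (f t) = ζ t := fun t ht => by
    have h1 := hfw t ht
    have h2 := hfw x ⟨by linarith, by linarith⟩
    simp only [Function.comp_apply, hψp, Complex.real_smul] at h1 h2
    rw [h1, hζ]
    simp only [h2]
    push_cast
    ring
  obtain ⟨u, hu, hure, hcase⟩ := exists_rotation hw
  set z : ℝ → ℂ := fun t => u * ζ t with hz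
  have hzc : Continuous z := by fun_prop
  have hzd : ∀ a b, dist (z a) (z b) = dist a b := fun a b => by
    have : z a - z b = u * ((a - b : ℝ) * w) := by
      simp only [hz, hζ]
      push_cast
      ring
    rw [dist_eq_norm, this, norm_mul, norm_mul, hu, hw, one_mul, mul_one, Complex.norm_real,
      Real.dist_eq, Real.norm_eq_abs]
  have hzre : ∀ t, (z t).re = u.re * (f x).radius + (t - x) * (u * w).re := fun t => by
    simp only [hz, hζ]
    simp
    ring
  have hzim : ∀ t, (z t).im = u.im * (f x).radius + (t - x) * (u * w).im := fun t => by
    simp only [hz, hζ]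
    simp
    ring
  have hzpos : ∀ t, 0 ≤ (z t).re → z t ≠ 0 → 0 < (z t).re := fun t h0 hne => by
    rcases hcase with hc | ⟨hc, hc'⟩
    · rw [hzre, hc, mul_zero, add_zero]
      positivity
    · refine h0.lt_of_ne fun h => hne (Complex.ext h.symm ?_)
      rw [hzim, hc, hc']
      simp
  -- Subtracting `u.arg` undoes the rotation by `u`, so that the model path `m` passes through `f x`
  -- at time `x`.
  set a : AddCircle θ := (f x).angle - (u.arg : AddCircle θ) with ha
  set m : ℝ → Polar θ := fun t => ofComplex a (z t) with hm
  have hmd : ∀ t, 0 < (z t).re → PreservesDistAt m t := fun t ht =>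
    ⟨{s | 0 < (z s).re}, (isOpen_lt continuous_const (Complex.continuous_re.comp hzc)).mem_nhds ht,
      fun p hp q hq => (dist_ofComplex hθ a hp hq).trans (hzd p q)⟩
  have hmr : ∀ t, ((m t).radius : ℝ) = ‖z t‖ := fun t => rfl
  have hzx : 0 < (z x).re := by
    rw [hzre, sub_self, zero_mul, add_zero]
    positivity
  have hmx : m x = f x := by
    have h1 : z x = (((f x).radius : ℝ) : ℂ) * u := by
      simp only [hz, hζ, sub_self, Complex.ofReal_zero, zero_mul, add_zero]
      ring
    have h2 : (z x).arg = u.arg := by rw [h1, Complex.arg_real_mul _ hrx]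
    have h3 : ‖z x‖₊ = (f x).radius := by
      apply NNReal.eq
      rw [coe_nnnorm, h1, norm_mul, hu, mul_one, Complex.norm_real, Real.norm_of_nonneg hrx.le]
    simp only [hm, ofComplex, h2, h3, ha, sub_add_cancel]
  have hxu : ∀ᶠ r in 𝓝 x, dist (f r) (m r) = 0 ∧ 0 < (z r).re := by
    have hmc := (hmd x hzx).continuousAt
    filter_upwards [Icc_mem_nhds (by linarith : x - ε < x) (by linarith : x < x + ε),
      hmc.preimage_mem_nhds (by rw [hmx]; exact ball_mem_nhds _ hrx),
      (isOpen_lt continuous_const (Complex.continuous_re.comp hzc)).mem_nhds hzx] with r hr1 hr2 hr3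
    refine ⟨?_, hr3⟩
    rw [← hψ _ (hball hr1).2 _ hr2, hfζ r hr1, hψi u (ζ r) hu hure hr3, dist_self]
  have hsub : I ⊆ {s | ∀ᶠ r in 𝓝 s, dist (f r) (m r) = 0 ∧ 0 < (z r).re} := by
    refine hI.subset_of_closure_inter_subset isOpen_setOfPred_eventually_nhds ⟨x, hx, hxu⟩ ?_
    rintro t ⟨htc, htI⟩
    have hfc := (hf t htI).continuousAt
    have hfr := (mem_closure_iff_frequently.1 htc).mono fun r hr => hr.self_of_nhds
    -- In the limit the radii still agree. As `f t` is not the vertex, `z t` is not the origin, and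
    -- so the line is still in the open half-plane at time `t`.
    have hnorm : ((f t).radius : ℝ) - ‖z t‖ = 0 := by
      have hc : ContinuousAt (fun r => ((f r).radius : ℝ) - ‖z r‖) t :=
        (continuous_radius.continuousAt.comp hfc).sub hzc.norm.continuousAt
      refine isClosed_singleton.mem_of_frequently_of_tendsto (s := {(0 : ℝ)}) ?_ hc
      exact hfr.mono fun r hr => sub_eq_zero.2 (radius_eq_of_dist_eq_zero hr.1)
    have hre : 0 ≤ (z t).re :=
      isClosed_Ici.mem_of_frequently_of_tendsto (hfr.mono fun r hr => mem_Ici.2 hr.2.le)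
        (Complex.continuous_re.comp hzc).continuousAt
    have hne : z t ≠ 0 := fun h => by
      rw [h, norm_zero, sub_zero] at hnorm
      exact (hr t htI).ne' (NNReal.eq hnorm)
    have hpos := hzpos t hre hne
    have hmt := hmd t hpos
    have h0 : dist (f t) (m t) = 0 :=
      isClosed_singleton.mem_of_frequently_of_tendsto (s := {(0 : ℝ)})
        (hfr.mono fun r hr => hr.1) (hfc.dist hmt.continuousAt)
    obtain ⟨φ, hφ, -⟩ := exists_chart hθ (f t)
    refine (eventually_dist_eq_zero (hf t htI) hmt h0 (hr t htI) φ hφ ?_).and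
      ((isOpen_lt continuous_const (Complex.continuous_re.comp hzc)).mem_nhds hpos)
    exact closure_mono (fun r hr => hr.mono fun _ h => h.1) htc
  have h1 := (hsub hx).self_of_nhds
  have h2 := (hsub hy).self_of_nhds
  have h3 : dist (f x) (f y) = dist (m x) (m y) := by
    have e1 := dist_triangle4 (f x) (m x) (m y) (f y)
    have e2 := dist_triangle4 (m x) (f x) (f y) (m y)
    rw [dist_comm (m y), h1.1, h2.1] at e1
    rw [dist_comm (m x) (f x), h1.1, h2.1] at e2
    linarith
  rw [h3, dist_ofComplex hθ a h1.2 h2.2, hzd]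

end ConeSurface

namespace ConeSurface

open Topology Metric Set Filter

theorem Cone.dist_eq_of_preservesDistAt {θ : ℝ} (hθ : 2 * Real.pi < θ) {f : ℝ → Cone θ}
    {I : Set ℝ} (hI : IsPreconnected I) (hf : ∀ t ∈ I, PreservesDistAt f t)
    (hv : ∀ t ∈ I, f t ≠ vertex θ) :
    ∀ x ∈ I, ∀ y ∈ I, dist (f x) (f y) = dist x y := by
  choose F hF using fun t => SeparationQuotient.surjective_mk (f t)
  have hd : ∀ a b, dist (F a) (F b) = dist (f a) (f b) := fun a b => by
    rw [← hF a, ← hF b, SeparationQuotient.dist_mk]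
  intro x hx y hy
  rw [← hd]
  refine Polar.dist_eq_of_preservesDistAt hθ hI (fun t ht => ?_) (fun t ht => ?_) x hx y hy
  · obtain ⟨U, hU, h⟩ := hf t ht
    exact ⟨U, hU, fun a ha b hb => (hd a b).trans (h a ha b hb)⟩
  · refine pos_iff_ne_zero.2 fun h => hv t ht ?_
    rw [← hF t]
    refine SeparationQuotient.mk_eq_mk.2 (Metric.inseparable_iff.2 ?_)
    simp [Polar.dist_def, h]

/-! ### Uniform scale on the surface and compactness -/

section Surface

variable {S : Type*} [MetricSpace S]

/-- Transfer along an isometric chart of the fact that local isometric maps on intervals which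
avoid a set `A` are isometric. -/
theorem exists_radius_of_chart {Y : Type*} [PseudoMetricSpace Y] {A U : Set S} {p : S}
    (hU : U ∈ 𝓝 p) (j : U → Y) (hj : Isometry j)
    (H : ∀ (f : ℝ → Y) (I : Set ℝ), IsPreconnected I → (∀ t ∈ I, PreservesDistAt f t) →
      (∀ t ∈ I, ∃ x : U, (x : S) ∉ A ∧ f t = j x) → ∀ x ∈ I, ∀ y ∈ I, dist (f x) (f y) = dist x y) :
    ∃ r > 0, ∀ γ : ℝ → S, IsLocalIsometric γ → (∀ t, γ t ∉ A) → ∀ I : Set ℝ, IsPreconnected I →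
      MapsTo γ I (ball p r) → ∀ x ∈ I, ∀ y ∈ I, dist (γ x) (γ y) = dist x y := by
  classical
  obtain ⟨r, hr, hball⟩ := Metric.mem_nhds_iff.1 hU
  refine ⟨r, hr, fun γ hγ hA I hI hmaps => ?_⟩
  -- The value outside the chart is arbitrary: only times with `γ t ∈ U` are used.
  let f : ℝ → Y := fun t => if h : γ t ∈ U then j ⟨γ t, h⟩ else j ⟨p, mem_of_mem_nhds hU⟩
  have hfj : ∀ t (h : γ t ∈ U), f t = j ⟨γ t, h⟩ := fun t h => dif_pos h
  have hfd : ∀ a b, γ a ∈ U → γ b ∈ U → dist (f a) (f b) = dist (γ a) (γ b) := fun a b ha hb => by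
    rw [hfj a ha, hfj b hb, hj.dist_eq, Subtype.dist_eq]
  have key := H f I hI (fun t ht => ?_)
    fun t ht => ⟨⟨γ t, hball (hmaps ht)⟩, hA t, hfj t _⟩
  · intro x hx y hy
    rw [← hfd x y (hball (hmaps hx)) (hball (hmaps hy)), key x hx y hy]
  · have hc : ContinuousAt γ t := PreservesDistAt.continuousAt (hγ t)
    obtain ⟨V, hV, h⟩ := hγ t
    refine ⟨V ∩ γ ⁻¹' ball p r,
      inter_mem hV (hc.preimage_mem_nhds (isOpen_ball.mem_nhds (hmaps ht))), fun a ha b hb => ?_⟩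
    rw [hfd a b (hball ha.2) (hball hb.2), h a ha.1 b hb.1]

theorem IsEuclideanConeSurface.exists_radius {n : ℕ} {s : Fin n → S} {θ : Fin n → ℝ}
    (hS : IsEuclideanConeSurface S s θ) (hθ : ∀ i, 2 * Real.pi < θ i) (p : S) :
    ∃ r > 0, ∀ γ : ℝ → S, IsLocalIsometric γ → (∀ t, γ t ∉ range s) → ∀ I : Set ℝ,
      IsPreconnected I → MapsTo γ I (ball p r) → ∀ x ∈ I, ∀ y ∈ I, dist (γ x) (γ y) = dist x y := by
  by_cases hp : p ∈ range s
  · obtain ⟨i, rfl⟩ := hp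
    obtain ⟨U, hU, V, -, e, he⟩ := hS.conical i
    refine exists_radius_of_chart hU (fun x => (e x : Cone (θ i)))
      (isometry_subtype_coe.comp e.isometry) fun f I hI hf hfU =>
        Cone.dist_eq_of_preservesDistAt (hθ i) hI hf fun t ht hv => ?_
    obtain ⟨x, hx, hfx⟩ := hfU t ht
    have hs := he ⟨s i, mem_of_mem_nhds hU⟩ rfl
    rw [hfx, ← hs] at hv
    have := e.injective (Subtype.ext hv)
    exact hx ⟨i, by rw [this]⟩
  · obtain ⟨U, hU, c, r, -, ⟨e⟩⟩ := hS.regular p hp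
    exact exists_radius_of_chart hU (fun x => (e x : EuclideanSpace ℝ (Fin 2)))
      (isometry_subtype_coe.comp e.isometry) fun f I hI hf _ => dist_eq_of_preservesDistAt hI hf

/-- Keeps `γ` inside one chart ball over a time interval of uniform length. The bound propagates to
the right by the triangle inequality. -/
theorem IsLocalIsometric.dist_le {γ : ℝ → S} (hγ : IsLocalIsometric γ) (x y : ℝ) :
    dist (γ x) (γ y) ≤ dist x y := by
  wlog hxy : x ≤ y generalizing x y
  · rw [dist_comm, dist_comm x]
    exact this y x (le_of_not_ge hxy)
  have hc : Continuous γ := continuous_iff_continuousAt.2 fun t =>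
    PreservesDistAt.continuousAt (hγ t)
  have hsub : Icc x y ⊆ {t | dist (γ x) (γ t) ≤ t - x} := by
    refine IsClosed.Icc_subset_of_forall_exists_gt
      ((isClosed_le (by fun_prop) (by fun_prop)).inter isClosed_Icc) (by simp) ?_
    rintro t ⟨ht, -⟩ b hb
    obtain ⟨U, hU, h⟩ := hγ t
    obtain ⟨ε, hε, hball⟩ := Metric.nhds_basis_closedBall.mem_iff.1 hU
    rw [mem_ofPred_eq] at ht
    have hb' : t < b := hb
    have hδ : 0 < min ε (b - t) := lt_min hε (sub_pos.2 hb')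
    refine ⟨t + min ε (b - t), ?_, by linarith, by linarith [min_le_right ε (b - t)]⟩
    have h1 := h t (mem_of_mem_nhds hU) (t + min ε (b - t)) (hball (by
      simp [abs_of_pos hδ]))
    rw [dist_self_add_right, Real.norm_of_nonneg hδ.le] at h1
    have h2 := dist_triangle (γ x) (γ t) (γ (t + min ε (b - t)))
    rw [mem_ofPred_eq]
    linarith
  have := hsub (right_mem_Icc.2 hxy)
  rwa [dist_comm x, Real.dist_eq, abs_of_nonneg (sub_nonneg.2 hxy)]

/-- Local geodesics that avoid the conical points are geodesics on a uniform scale. -/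
theorem IsEuclideanConeSurface.exists_scale {n : ℕ} {s : Fin n → S} {θ : Fin n → ℝ}
    (hS : IsEuclideanConeSurface S s θ) (hθ : ∀ i, 2 * Real.pi < θ i) :
    ∃ δ > 0, ∀ γ : ℝ → S, IsLocalIsometric γ → (∀ t, γ t ∉ range s) →
      ∀ x y, dist x y < δ → dist (γ x) (γ y) = dist x y := by
  have := hS.compact
  choose r hr hγ using hS.exists_radius hθ
  obtain ⟨δ, hδ, h⟩ := lebesgue_number_lemma_of_metric (isCompact_univ (X := S))
    (fun p => isOpen_ball (x := p) (ε := r p))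
    (fun p _ => mem_iUnion.2 ⟨p, mem_ball_self (hr p)⟩)
  refine ⟨δ, hδ, fun γ hloc hs x y hxy => ?_⟩
  obtain ⟨p, hp⟩ := h (γ x) (mem_univ _)
  refine hγ p γ hloc hs (ball x δ) (convex_ball x δ).isPreconnected (fun t ht => hp ?_)
    x (mem_ball_self hδ) y (by rwa [mem_ball, dist_comm])
  exact (hloc.dist_le t x).trans_lt ht

/-- The maps that preserve distances less than `δ` form a compact set. -/
theorem isCompact_setOf_dist_eq [CompactSpace S] {δ : ℝ} (hδ : 0 < δ) :
    IsCompact {γ : C(ℝ, S) | ∀ x y, dist x y < δ → dist (γ x) (γ y) = dist x y} := by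
  have heq : ∀ γ : ℝ → S, (∀ x y, dist x y < δ → dist (γ x) (γ y) = dist x y) → ∀ x ε, 0 < ε →
      ∀ y, dist x y < min δ ε → dist (γ x) (γ y) < ε := fun γ hγ x ε hε y hy => by
    rw [hγ x y (hy.trans_le (min_le_left _ _))]
    exact hy.trans_le (min_le_right _ _)
  refine ArzelaAscoli.isCompact_of_equicontinuous _ ?_ ?_
  -- Continuity is automatic for such maps, so the image in the product `ℝ → S` is cut out by closed
  -- conditions and is compact by Tychonoff.
  · have himg : ContinuousMap.toFun ''
        {γ : C(ℝ, S) | ∀ x y, dist x y < δ → dist (γ x) (γ y) = dist x y}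
        = {γ : ℝ → S | ∀ x y, dist x y < δ → dist (γ x) (γ y) = dist x y} := by
      ext γ
      refine ⟨?_, fun h => ⟨⟨γ, ?_⟩, h, rfl⟩⟩
      · rintro ⟨γ, h, rfl⟩
        exact h
      · exact continuous_iff_continuousAt.2 fun x => PreservesDistAt.continuousAt
          ⟨ball x (δ / 2), ball_mem_nhds x (half_pos hδ), fun a ha b hb => h a b (by
            have := dist_triangle_right a b x
            rw [mem_ball] at ha hb
            linarith)⟩
    rw [himg]
    refine IsClosed.isCompact ?_
    simp only [ofPred_forall]
    exact isClosed_iInter fun x => isClosed_iInter fun y => isClosed_iInter fun _ =>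
      isClosed_eq ((continuous_apply x).dist (continuous_apply y)) continuous_const
  · intro x
    rw [Metric.equicontinuousAt_iff]
    intro ε hε
    refine ⟨min δ ε, lt_min hδ hε, fun y hy γ => heq γ γ.2 x ε hε y ?_⟩
    rwa [dist_comm]

end Surface

/-! ### Orbits of the geodesic flow -/

section Flow

variable {S : Type*} [MetricSpace S]

theorem geodesicFlow_apply (t : ℝ) (γ : GeodesicSpace S) (u : ℝ) :
    (geodesicFlow t γ).1 u = γ.1 (t + u) := rfl

theorem geodesicFlow_add (t t' : ℝ) (γ : GeodesicSpace S) :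
    geodesicFlow (t + t') γ = geodesicFlow t (geodesicFlow t' γ) := by
  ext u
  simp only [geodesicFlow_apply]
  congr 1
  ring

theorem continuous_geodesicFlow (γ : GeodesicSpace S) :
    Continuous fun t : ℝ => geodesicFlow t γ := by
  refine Continuous.subtype_mk ?_ _
  exact (ContinuousMap.curry ⟨fun q : ℝ × ℝ => γ.1 (q.1 + q.2), by fun_prop⟩).continuous

theorem continuous_geodesicFlow_left (t : ℝ) :
    Continuous (geodesicFlow t : GeodesicSpace S → GeodesicSpace S) :=
  Continuous.subtype_mk ((ContinuousMap.continuous_precomp _).comp continuous_subtype_val) _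

theorem isPeriodic_of_geodesicFlow_eq {γ : GeodesicSpace S} {a b : ℝ} (hab : a < b)
    (h : geodesicFlow a γ = geodesicFlow b γ) : IsPeriodic γ := by
  refine ⟨b - a, sub_pos.2 hab, fun u => ?_⟩
  have := congrArg (fun η : GeodesicSpace S => η.1 (u - a)) h
  simp only [geodesicFlow_apply] at this
  rw [show a + (u - a) = u by ring, show b + (u - a) = u + (b - a) by ring] at this
  exact this.symm

theorem IsPeriodic.isClosed_flowOrbit {γ : GeodesicSpace S} (h : IsPeriodic γ) :
    IsClosed (flowOrbit γ) := by
  obtain ⟨T, hT, hper⟩ := h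
  have hp : Function.Periodic (fun t : ℝ => geodesicFlow t γ) T := fun t => by
    ext u
    simp only [geodesicFlow_apply]
    rw [add_right_comm, hper]
  rw [flowOrbit, ← hp.image_Icc hT 0]
  exact (isCompact_Icc.image (continuous_geodesicFlow γ)).isClosed

/-- A compact orbit of the geodesic flow is periodic. -/
theorem isPeriodic_of_isCompact_flowOrbit {γ : GeodesicSpace S} (h : IsCompact (flowOrbit γ)) :
    IsPeriodic γ := by
  have : CompactSpace (flowOrbit γ) := isCompact_iff_compactSpace.1 h
  let c : ℝ → flowOrbit γ := fun t => ⟨geodesicFlow t γ, t, rfl⟩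
  have hc : Continuous c := (continuous_geodesicFlow γ).subtype_mk _
  have : Nonempty (flowOrbit γ) := ⟨c 0⟩
  -- Baire: some arc of times in `[-N, N]` has an interior point, say `c a`.
  obtain ⟨N, x, hx⟩ := nonempty_interior_of_iUnion_of_closed
    (f := fun N : ℕ => c '' Icc (-(N : ℝ)) N)
    (fun N => (isCompact_Icc.image hc).isClosed) (by
      refine eq_univ_of_forall ?_
      rintro ⟨-, t, rfl⟩
      obtain ⟨N, hN⟩ := exists_nat_ge |t|
      exact mem_iUnion.2 ⟨N, t, abs_le.1 hN, rfl⟩)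
  obtain ⟨a, -, rfl⟩ := interior_subset hx
  obtain ⟨⟨-, b, rfl⟩, -, hb⟩ := (isCompact_univ (X := flowOrbit γ)).exists_mapClusterPt
    (f := atTop) (u := fun k : ℕ => c k) (by simp)
  -- The integer times accumulate at `c b`, and `σ` moves `c b` to `c a`. Hence `c (a - b + k)` lies
  -- in the arc for arbitrarily large `k`.
  let σ : flowOrbit γ → flowOrbit γ := fun y => ⟨geodesicFlow (a - b) y.1, by
    obtain ⟨-, t, rfl⟩ := y
    exact ⟨a - b + t, geodesicFlow_add _ _ _⟩⟩
  have hσc : ∀ t, σ (c t) = c (a - b + t) := fun t => Subtype.ext (geodesicFlow_add _ _ _).symm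
  have hσ : Continuous σ :=
    ((continuous_geodesicFlow_left (a - b)).comp continuous_subtype_val).subtype_mk _
  have hmem : σ ⁻¹' interior (c '' Icc (-(N : ℝ)) N) ∈ 𝓝 (c b) :=
    (isOpen_interior.preimage hσ).mem_nhds (by
      rw [mem_preimage, hσc, sub_add_cancel]
      exact hx)
  have hfr : ∃ᶠ k : ℕ in atTop, c k ∈ σ ⁻¹' interior (c '' Icc (-(N : ℝ)) N) :=
    hb.frequently hmem
  -- For `k ≥ M` the time `a - b + k` exceeds `N`, so it differs from the time in `[-N, N]` giving
  -- the same point.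
  obtain ⟨M, hM⟩ := exists_nat_gt (N - (a - b))
  obtain ⟨k, hk, hkM⟩ := (hfr.and_eventually (eventually_ge_atTop M)).exists
  rw [mem_preimage, hσc] at hk
  obtain ⟨t, ht, htk⟩ := interior_subset hk
  have hkM' : (M : ℝ) ≤ k := Nat.cast_le.2 hkM
  exact isPeriodic_of_geodesicFlow_eq (by linarith [ht.2] : t < a - b + k)
    (congrArg Subtype.val htk)

/-- If `γ` is a geodesic on a uniform scale and its orbit is closed, then the orbit is compact. -/
theorem isCompact_flowOrbit_of_isClosed [CompactSpace S] {γ : GeodesicSpace S} {δ : ℝ} (hδ : 0 < δ)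
    (hγ : ∀ x y, dist x y < δ → dist (γ.1 x) (γ.1 y) = dist x y)
    (hcl : IsClosed (flowOrbit γ)) : IsCompact (flowOrbit γ) := by
  -- Maps preserving distances below `δ` are local isometric, so the whole compact set lies in the
  -- geodesic space and stays compact there.
  have hK := (IsInducing.subtypeVal (t := {η : C(ℝ, S) | IsLocalIsometric η})).isCompact_preimage'
    (isCompact_setOf_dist_eq (S := S) hδ) (fun η hη => ⟨⟨η, fun x =>
      ⟨ball x (δ / 2), ball_mem_nhds x (half_pos hδ), fun a ha b hb => hη a b (by
        have := dist_triangle_right a b x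
        rw [mem_ball] at ha hb
        linarith)⟩⟩, rfl⟩)
  refine hK.of_isClosed_subset hcl ?_
  rintro - ⟨t, rfl⟩ x y hxy
  have := hγ (t + x) (t + y) (by rwa [dist_add_left])
  rwa [dist_add_left] at this

end Flow

end ConeSurface

theorem proposition3p5 {S : Type*} [MetricSpace S] {n : ℕ} (s : Fin n → S) (θ : Fin n → ℝ)
    (hS : ConeSurface.IsEuclideanConeSurface S s θ) (hθ : ∀ i, 2 * Real.pi < θ i)
    (g : ConeSurface.GeodesicSpace S) (hg : ∀ (t : ℝ) (i : Fin n), g.1 t ≠ s i) :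
    List.TFAE
      [¬ ConeSurface.IsPeriodic g,
        (closure (ConeSurface.flowOrbit g) \ ConeSurface.flowOrbit g).Nonempty,
        ¬ IsClosed (ConeSurface.flowOrbit g)] := by
  have := hS.compact
  tfae_have 2 ↔ 3 := by
    rw [Set.sdiff_nonempty, closure_subset_iff_isClosed]
  tfae_have 3 → 1 := fun h hp => h hp.isClosed_flowOrbit
  tfae_have 1 → 3 := fun h hcl => by
    obtain ⟨δ, hδ, hscale⟩ := hS.exists_scale hθ
    refine h (ConeSurface.isPeriodic_of_isCompact_flowOrbit
      (ConeSurface.isCompact_flowOrbit_of_isClosed hδ (hscale g.1 g.2 ?_) hcl))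
    rintro t ⟨i, hi⟩
    exact hg t i hi.symm
  tfae_finish
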